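/- **Setting.** Each of $n$ users holds an item $X_i\in\{e_1,\dots,e_d\}$ (one-hot vectors in $\mathbb R^d$). In a single-server aggregation protocol, user $i$ sends a message $Y_i=g_i(X_i;\theta_i)$ from a countable alphabet, where the randomness $\theta_{[n]}=(\theta_1,\dots,\theta_n)$ is jointly distributed in an arbitrary way and is independent of $X^n=(X_1,\dots,X_n)$. If a nonempty set $\mathcal D\subseteq[n]$ of users drops out, the server moreover collects a second-round message $h(\theta_{[n]},\mathcal D)$ (there is no second round if $\mathcal D=\emptyset$). Without dropouts the server outputs $\hat\mu=f(Y^n)$, with $f$ deterministic, as its estimate of the histogram $\mu(X^n)=\sum_i X_i$; write $\mu(X_{[n]\setminus\mathcal D})=\sum_{i\notin\mathcal D}X_i$. For a dropout tolerance $D$, the security constraints are: for every joint distribution of $X^n$, - (S1) $I\big(Y_{[n]\setminus\mathcal D},h(\theta_{[n]},\mathcal D);X_{[n]\setminus\mathcal D}\,\big|\,\mu(X_{[n]\setminus\mathcal D})\big)=0$ for all $\mathcal D\subseteq[n]$; - (S2) $I\big(Y_{[n]\setminus\mathcal D},h(\theta_{[n]},\mathcal D);X_{[n]\setminus\mathcal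 D}\big)=0$ for all $\mathcal D\subseteq [n]$ with $|\mathcal D|>D$. The protocol is $(\varepsilon,\delta)$-central DP if $\Pr(\hat\mu(x)\in S)\le e^{\varepsilon}\Pr(\hat\mu(x')\in S)+\delta$ for all measurable $S\subseteq\mathbb R^d$ and all $x,x'$ that differ in the item of one user. The communication cost of user $i$ is $\sup_{P_{X^n}}H(Y_i)$, with $H$ the Shannon entropy in bits. **Statement.** For all constants $\kappa>0$ and $C>0$ there is a constant $c>0$, depending only on $\kappa$ and $C$, such that the following holds for all $n,d,D$ with $d\ge n^{1+\kappa}$, all $\varepsilon>0$, $\delta\in(0,1)$, and every $(\varepsilon,\delta)$-central DP protocol that satisfies (S1) and (S2). - *($\ell_\infty$ loss.)* If for every input $x$ the error $\mathbb E\|\hat\mu-\mu(x)\|_\infty$ is at most $C\,\dfrac{\sqrt{\log d\,\log(1/\delta)}}{\varepsilon}$ and at most $\dfrac n4$, then the communication cost of every user is at least $$c\;n\,\min\!\Big(\varepsilon\sqrt{\tfrac{\log d}{\log(1/\delta)}},\ \log d\Big)\ \text{bits}.$$ - *(Squared $\ell_2$ loss.)* If for every input $x$ the error $\mathbb E\|\hat\mu-\mu(x)\|_2^2$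 is at most $C\,\dfrac{n\log d\,\log(1/\delta)}{\varepsilon^2}$ and at most $\dfrac{n^2}4$, then the communication cost of every user is at least $$c\;n\,\min\!\Big(\tfrac{\varepsilon^2}{\log(1/\delta)},\ \log d\Big)\ \text{bits},$$ and hence, if $\varepsilon\ge1$, at least $c\,n\min\!\big(\tfrac{\varepsilon}{\log(1/\delta)},\log d\big)$ bits. -/

import Mathlib

open MeasureTheory ProbabilityTheory InformationTheory
open scoped ENNReal

universe u

noncomputable section

/-- Shannon entropy, in bits, of a random variable with values in a countable discrete space. -/
def entropyBits {Ω α : Type*} [MeasurableSpace Ω] [MeasurableSpace α] [Countable α]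
    (μ : Measure Ω) (Y : Ω → α) : ℝ≥0∞ :=
  ∑' y : α, ENNReal.ofReal (Real.negMulLog ((μ.map Y).real {y}) / Real.log 2)

/-- Mutual information `I(U; V)`: the Kullback-Leibler divergence of the joint law from the
product of the marginal laws. -/
def mutualInfo {Ω α β : Type*} [MeasurableSpace Ω] [MeasurableSpace α] [MeasurableSpace β]
    (μ : Measure Ω) (U : Ω → α) (V : Ω → β) : ℝ≥0∞ :=
  klDiv (μ.map fun ω => (U ω, V ω)) ((μ.map U).prod (μ.map V))

/-- Conditional mutual information `I(U; V | W)` given a random variable `W` with countably many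
values: the average of the mutual informations under the laws conditioned on `W = w`. -/
def condMutualInfo {Ω α β γ : Type*} [MeasurableSpace Ω] [MeasurableSpace α] [MeasurableSpace β]
    [Countable γ] (μ : Measure Ω) (U : Ω → α) (V : Ω → β) (W : Ω → γ) : ℝ≥0∞ :=
  ∑' w : γ, μ (W ⁻¹' {w}) * mutualInfo (μ[|W ⁻¹' {w}]) U V

/-- The sum of the one-hot vectors `e_{x i}` of the users outside the dropout set `𝒟`. -/
def histogram {n d : ℕ} (𝒟 : Finset (Fin n)) (x : Fin n → Fin d) : Fin d → ℕ :=
  ∑ i ∈ 𝒟ᶜ, Pi.single (x i) 1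

/-- A single-server aggregation protocol for `n` users, where user `i` holds an item of a domain
of size `d` (the item `j : Fin d` stands for the one-hot vector `e_j`). -/
structure AggregationProtocol (n d : ℕ) where
  /-- The values of the local randomness `θ_i`. -/
  Seed : Fin n → Type u
  [seedSpace : ∀ i, MeasurableSpace (Seed i)]
  /-- The joint law of `(θ_1, …, θ_n)`; the `θ_i` may depend on each other. -/
  seedLaw : Measure (∀ i, Seed i)
  [seedProb : IsProbabilityMeasure seedLaw]
  /-- The message alphabets of the users. -/
  Msg : Fin n → Type u
  [msgSpace : ∀ i, MeasurableSpace (Msg i)]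
  [msgCountable : ∀ i, Countable (Msg i)]
  [msgDiscrete : ∀ i, DiscreteMeasurableSpace (Msg i)]
  /-- The values of what the server collects in the second round. -/
  Aux : Type u
  [auxSpace : MeasurableSpace Aux]
  /-- The encoding functions `Y_i = g_i(X_i; θ_i)`. -/
  encode : ∀ i, Fin d → Seed i → Msg i
  measurable_encode : ∀ i j, Measurable (encode i j)
  /-- The second-round information `h(θ, 𝒟)`. -/
  aux : Finset (Fin n) → (∀ i, Seed i) → Aux
  measurable_aux : ∀ 𝒟, Measurable (aux 𝒟)
  /-- There is no second round when nobody drops out. -/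
  aux_empty : ∀ θ θ', aux ∅ θ = aux ∅ θ'
  /-- The server's (deterministic) aggregation function. -/
  estimate : ∀ 𝒟 : Finset (Fin n), (∀ i : {i // i ∉ 𝒟}, Msg i) × Aux → (Fin d → ℝ)
  measurable_estimate : ∀ 𝒟, Measurable (estimate 𝒟)

attribute [instance] AggregationProtocol.seedSpace AggregationProtocol.seedProb
  AggregationProtocol.msgSpace AggregationProtocol.msgCountable AggregationProtocol.msgDiscrete
  AggregationProtocol.auxSpace

namespace AggregationProtocol

variable {n d : ℕ} (p : AggregationProtocol.{u} n d)

/-- Everything the server observes: the messages of the surviving users and the second-round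
information. -/
def view (𝒟 : Finset (Fin n)) (x : Fin n → Fin d) (θ : ∀ i, p.Seed i) :
    (∀ i : {i // i ∉ 𝒟}, p.Msg i) × p.Aux :=
  (fun i => p.encode i (x i) (θ i), p.aux 𝒟 θ)

/-- The server's estimate of the histogram when nobody drops out; a function of the messages
of the `n` users. -/
def output (x : Fin n → Fin d) (θ : ∀ i, p.Seed i) : Fin d → ℝ :=
  p.estimate ∅ (p.view ∅ x θ)

/-- The joint law of the data and the randomness, which are independent, when the data vector
has the (arbitrary) joint distribution `π`. -/
def jointLaw (π : PMF (Fin n → Fin d)) : Measure ((Fin n → Fin d) × (∀ i, p.Seed i)) :=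
  π.toMeasure.prod p.seedLaw

/-- Given the sum of the data of the surviving users, the server learns nothing more about these
data, whatever the dropout set and the distribution of the data. -/
def S1 : Prop :=
  ∀ π : PMF (Fin n → Fin d), ∀ 𝒟 : Finset (Fin n),
    condMutualInfo (p.jointLaw π) (fun ω => p.view 𝒟 ω.1 ω.2)
      (fun ω (i : {i // i ∉ 𝒟}) => ω.1 i) (fun ω => histogram 𝒟 ω.1) = 0

/-- When more than `D` users drop out, the server learns nothing about the surviving users. -/
def S2 (D : ℕ) : Prop :=
  ∀ π : PMF (Fin n → Fin d), ∀ 𝒟 : Finset (Fin n), D < 𝒟.card →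
    mutualInfo (p.jointLaw π) (fun ω => p.view 𝒟 ω.1 ω.2)
      (fun ω (i : {i // i ∉ 𝒟}) => ω.1 i) = 0

/-- Central `(ε, δ)`-differential privacy of the server's estimate, where neighbouring data sets
differ in the item of one user. -/
def CentralDP (ε δ : ℝ) : Prop :=
  ∀ (x : Fin n → Fin d) (i : Fin n) (a : Fin d) (S : Set (Fin d → ℝ)), MeasurableSet S →
    p.seedLaw.real {θ | p.output x θ ∈ S} ≤
      Real.exp ε * p.seedLaw.real {θ | p.output (Function.update x i a) θ ∈ S} + δ

/-- The worst-case expected `ℓ_∞` error is at most `b`. -/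
def LInftyErrorLE (b : ℝ) : Prop :=
  ∀ x : Fin n → Fin d,
    ∫⁻ θ, ENNReal.ofReal ‖p.output x θ - fun j => (histogram ∅ x j : ℝ)‖ ∂p.seedLaw
      ≤ ENNReal.ofReal b

/-- The worst-case expected squared `ℓ_2` error is at most `b`. -/
def L2SqErrorLE (b : ℝ) : Prop :=
  ∀ x : Fin n → Fin d,
    ∫⁻ θ, ENNReal.ofReal (∑ j, (p.output x θ j - (histogram ∅ x j : ℝ)) ^ 2) ∂p.seedLaw
      ≤ ENNReal.ofReal b

/-- The communication cost of user `i`: the worst-case entropy of the message `Y_i` over all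
joint distributions of the data. -/
def commCost (i : Fin n) : ℝ≥0∞ :=
  ⨆ π : PMF (Fin n → Fin d),
    entropyBits (p.jointLaw π) (fun ω => p.encode i (ω.1 i) (ω.2 i))

end AggregationProtocol

end

/-! Apply `S1` with no dropouts: the law of all messages depends on the data only through the
histogram. Exchanging the items of user `j` and of another user keeps the histogram, so once the
message of `j` is masked, the law of the remaining messages no longer depends on the data
(`S1.map_update_messages_eq`). Each single message `Y_j` must therefore carry everything that the
server learns.

This becomes an entropy bound by list decoding (`S1.mul_le_commCost`). Draw the data uniformly from
a finite family. If `Y_j` mostly took one of `N` values, trying these values would replace the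
server by `N` guesses independent of the data, and each guess can be close to only few members of
the family. Hence `Y_j` often falls outside its atoms of mass at least `1 / L`, and there each value
contributes at least `logb 2 L` per unit of mass.

The family consists of the words of length `k` over `q = d / k` letters: `k` groups of about `n / k`
users, each group sharing one item from its own block. A small multiple of `n / k` as `ℓ_∞` error
identifies the word; a small multiple of `n ^ 2 / k` as squared `ℓ_2` error confines it to words
that pairwise agree on half of the blocks, of which there are at most `(2 * √q) ^ k`. Both give a
cost of order `k * log q`. It remains to take `k` as large as the error allows, capped at `n`; then
`d ≥ n ^ (1 + κ)` makes `log q` comparable to `log d`. When the privacy-type error bound allows no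
block at all, the bounds `n / 4` and `n ^ 2 / 4` still allow `k = 1`. -/

/-! ### Entropy and zero mutual information -/

/-- A discrete distribution has at most `L` atoms of mass at least `1 / L`, and each of the other
atoms contributes at least `logb 2 L` times its mass to the entropy. -/
theorem exists_finset_logb_mul_measure_compl_le_entropy {α : Type*} [MeasurableSpace α]
    [Countable α] [DiscreteMeasurableSpace α] (ν : Measure α) [IsProbabilityMeasure ν]
    {L : ℝ} (hL : 1 ≤ L) {N : ℕ} (hN : L < N + 1) :
    ∃ A : Finset α, A.card ≤ N ∧
      ENNReal.ofReal (Real.logb 2 L) * ν (↑A)ᶜ ≤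
        ∑' y : α, ENNReal.ofReal (Real.negMulLog (ν.real {y}) / Real.log 2) := by
  classical
  have hL0 : 0 < L := by linarith
  have hcard : ∀ B : Finset α, (∀ y ∈ B, 1 / L ≤ ν.real {y}) → B.card ≤ N := by
    intro B hB
    have h1 : ∑ y ∈ B, ν.real {y} ≤ 1 := by
      have := measureReal_biUnion_finset (μ := ν) (s := B) (f := fun y => ({y} : Set α))
        (fun a _ b _ hab => by simpa using hab) (fun _ _ => MeasurableSet.of_discrete)
      rw [← this]
      exact measureReal_le_one
    have h2 : B.card • (1 / L) ≤ ∑ y ∈ B, ν.real {y} := Finset.card_nsmul_le_sum _ _ _ hB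
    have h3 : (B.card : ℝ) ≤ L := by
      have := h2.trans h1
      rw [nsmul_eq_mul, mul_one_div, div_le_one hL0] at this
      exact this
    have : (B.card : ℝ) < N + 1 := h3.trans_lt hN
    exact Nat.lt_succ_iff.mp (by exact_mod_cast this)
  have hfin : {y | 1 / L ≤ ν.real {y}}.Finite := by
    by_contra h
    obtain ⟨B, hB, hBc⟩ := Set.Infinite.exists_subset_card_eq h (N + 1)
    have := hcard B (fun y hy => hB hy)
    omega
  refine ⟨hfin.toFinset, hcard _ (by simp), ?_⟩
  have hmeas : ν (↑hfin.toFinset)ᶜ = ∑' y, (↑hfin.toFinset : Set α)ᶜ.indicator (fun y => ν {y}) y :=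
    (ν.tsum_indicator_apply_singleton _ MeasurableSet.of_discrete).symm
  rw [hmeas, ← ENNReal.tsum_mul_left]
  refine ENNReal.tsum_le_tsum fun y => ?_
  by_cases hy : 1 / L ≤ ν.real {y}
  · have hy' : y ∉ ((↑hfin.toFinset : Set α)ᶜ) := by simpa using hy
    rw [Set.indicator_of_notMem hy', mul_zero]
    exact zero_le
  · have hy' : y ∈ ((↑hfin.toFinset : Set α)ᶜ) := by simpa using hy
    rw [Set.indicator_of_mem hy', ← ofReal_measureReal, ← ENNReal.ofReal_mul
      (Real.logb_nonneg one_lt_two hL)]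
    refine ENNReal.ofReal_le_ofReal ?_
    rcases (measureReal_nonneg (μ := ν) (s := {y})).eq_or_lt with h0 | h0
    · simp [← h0]
    · rw [Real.logb, div_mul_eq_mul_div, Real.negMulLog]
      refine div_le_div_of_nonneg_right ?_ (Real.log_nonneg one_le_two)
      have : Real.log (ν.real {y}) ≤ -Real.log L := by
        rw [← Real.log_inv]
        exact Real.log_le_log h0 (by rw [← one_div]; exact (not_le.mp hy).le)
      nlinarith

/-- If `U` and `V` have zero mutual information, the law of `U` on the event `V = v`. -/
theorem measure_inter_eq_mul_of_mutualInfo_eq_zero {Ω α β : Type*} [MeasurableSpace Ω]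
    [MeasurableSpace α] [MeasurableSpace β] {μ : Measure Ω} [IsFiniteMeasure μ]
    {U : Ω → α} {V : Ω → β} (hU : Measurable U) (hV : Measurable V)
    (h : mutualInfo μ U V = 0) {A : Set α} {B : Set β} (hA : MeasurableSet A)
    (hB : MeasurableSet B) :
    μ (U ⁻¹' A ∩ V ⁻¹' B) = μ (U ⁻¹' A) * μ (V ⁻¹' B) := by
  rw [mutualInfo, klDiv_eq_zero_iff] at h
  have := congrArg (fun m => m (A ×ˢ B)) h
  simp only [Measure.prod_prod] at this
  rwa [Measure.map_apply (hU.prodMk hV) (hA.prod hB), Measure.map_apply hU hA,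
    Measure.map_apply hV hB] at this

/-! ### Masked messages and list decoding -/

namespace AggregationProtocol

variable {n d : ℕ} (p : AggregationProtocol.{u} n d)

/-- The messages of all users. -/
def messages (x : Fin n → Fin d) (θ : ∀ i, p.Seed i) : ∀ i, p.Msg i :=
  fun i => p.encode i (x i) (θ i)

theorem measurable_messages (x : Fin n → Fin d) : Measurable (p.messages x) :=
  measurable_pi_lambda _ fun i => (p.measurable_encode i (x i)).comp (measurable_pi_apply i)

/-- Without dropouts the second-round value is constant, so it can be frozen at any seed. The
estimate then still makes sense for a message vector with one overwritten entry. -/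
theorem exists_output_eq_comp_messages :
    ∃ f : (∀ i, p.Msg i) → Fin d → ℝ, ∀ x θ, p.output x θ = f (p.messages x θ) := by
  obtain ⟨θ₀⟩ : Nonempty (∀ i, p.Seed i) := nonempty_of_isProbabilityMeasure p.seedLaw
  refine ⟨fun y => p.estimate ∅ (fun i => y i, p.aux ∅ θ₀), fun x θ => ?_⟩
  simp only [output, view, messages, p.aux_empty θ θ₀]

theorem measurable_view (𝒟 : Finset (Fin n)) :
    Measurable fun ω : (Fin n → Fin d) × (∀ i, p.Seed i) => p.view 𝒟 ω.1 ω.2 := by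
  refine measurable_from_prod_countable_right fun x => ?_
  refine Measurable.prodMk (measurable_pi_iff.mpr fun i => ?_) (p.measurable_aux 𝒟)
  exact (p.measurable_encode i (x i)).comp (measurable_pi_apply i.1)

theorem jointLaw_singleton_prod (π : PMF (Fin n → Fin d)) (x : Fin n → Fin d)
    (B : Set (∀ i, p.Seed i)) : p.jointLaw π ({x} ×ˢ B) = π x * p.seedLaw B := by
  rw [jointLaw, Measure.prod_prod, PMF.toMeasure_apply_singleton _ _ (measurableSet_singleton x)]

instance (π : PMF (Fin n → Fin d)) : IsProbabilityMeasure (p.jointLaw π) := by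
  unfold jointLaw; infer_instance

variable {p}

/-- Under `S1` the joint law of all messages depends on the data only through the histogram. -/
theorem S1.map_messages_eq (h : p.S1) {x x' : Fin n → Fin d}
    (hx : histogram ∅ x = histogram ∅ x') :
    p.seedLaw.map (p.messages x) = p.seedLaw.map (p.messages x') := by
  classical
  have : Nonempty (Fin n → Fin d) := ⟨x⟩
  -- Full support: every single input has positive mass, so independence given the histogram yields
  -- an identity for each input separately.
  set π := PMF.uniformOfFintype (Fin n → Fin d) with hπ
  set w := histogram ∅ x with hw
  set W := fun ω : (Fin n → Fin d) × (∀ i, p.Seed i) => histogram ∅ ω.1 with hW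
  have hWm : MeasurableSet (W ⁻¹' {w}) := by
    have : MeasurableSet {y : Fin n → Fin d | histogram ∅ y = w} := MeasurableSet.of_discrete
    exact measurable_fst this
  have hnull : p.jointLaw π (W ⁻¹' {w}) ≠ 0 := by
    intro h0
    have : p.jointLaw π ({x} ×ˢ Set.univ) = 0 := by
      refine measure_mono_null ?_ h0
      rintro ⟨y, θ⟩ ⟨hy, -⟩
      simp only [Set.mem_singleton_iff] at hy
      simp [hW, hy, hw]
    rw [jointLaw_singleton_prod] at this
    simp [hπ, PMF.uniformOfFintype_apply] at this
  have hI := h π ∅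
  rw [condMutualInfo, ENNReal.tsum_eq_zero] at hI
  have hI' := (mul_eq_zero.mp (hI w)).resolve_left hnull
  have hV : Measurable fun (ω : (Fin n → Fin d) × (∀ i, p.Seed i))
      (i : {i // i ∉ (∅ : Finset (Fin n))}) => ω.1 i := by fun_prop
  have key : ∀ y : Fin n → Fin d, histogram ∅ y = w → ∀ A : Set (∀ i, p.Msg i), MeasurableSet A →
      p.seedLaw (p.messages y ⁻¹' A) =
        (p.jointLaw π)[|W ⁻¹' {w}] ((fun ω => p.messages ω.1 ω.2) ⁻¹' A) := by
    intro y hy A hA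
    have hr : Measurable fun u : (∀ i : {i // i ∉ (∅ : Finset (Fin n))}, p.Msg i) × p.Aux =>
        ((fun i => u.1 ⟨i, Finset.notMem_empty i⟩) : ∀ i, p.Msg i) := by fun_prop
    have := measure_inter_eq_mul_of_mutualInfo_eq_zero (p.measurable_view ∅) hV hI' (hr hA)
      (measurableSet_singleton (fun i : {i // i ∉ (∅ : Finset (Fin n))} => y i))
    have hVy : (fun (ω : (Fin n → Fin d) × (∀ i, p.Seed i))
        (i : {i // i ∉ (∅ : Finset (Fin n))}) => ω.1 i) ⁻¹'
          ({fun i => y i.1} : Set ({i // i ∉ (∅ : Finset (Fin n))} → Fin d)) =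
        {y} ×ˢ Set.univ := by
      ext ⟨z, θ⟩
      simp [funext_iff]
    rw [hVy] at this
    have e1 : W ⁻¹' {w} ∩ ({y} ×ˢ Set.univ) = {y} ×ˢ (Set.univ : Set (∀ i, p.Seed i)) := by
      refine Set.inter_eq_right.mpr ?_
      rintro ⟨z, θ⟩ ⟨hz, -⟩
      simp only [Set.mem_singleton_iff] at hz
      simp [hW, hz, hy]
    have e2 : W ⁻¹' {w} ∩ ((fun ω : (Fin n → Fin d) × (∀ i, p.Seed i) => p.view ∅ ω.1 ω.2) ⁻¹'
        ((fun u => ((fun i => u.1 ⟨i, Finset.notMem_empty i⟩) : ∀ i, p.Msg i)) ⁻¹' A) ∩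
        {y} ×ˢ Set.univ) = {y} ×ˢ (p.messages y ⁻¹' A) := by
      ext ⟨z, θ⟩
      simp only [Set.mem_inter_iff, Set.mem_preimage, Set.mem_singleton_iff, Set.mem_prod,
        Set.mem_univ, and_true, hW]
      constructor
      · rintro ⟨-, h2, rfl⟩
        exact ⟨rfl, h2⟩
      · rintro ⟨rfl, h2⟩
        exact ⟨hy, h2, rfl⟩
    -- The mass of the input `y` under the conditioned law; being nonzero and finite, it cancels.
    have hne : (p.jointLaw π (W ⁻¹' {w}))⁻¹ * π y ≠ 0 := by
      refine mul_ne_zero (ENNReal.inv_ne_zero.mpr (measure_ne_top _ _)) ?_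
      simp [hπ, PMF.uniformOfFintype_apply]
    have hnt : (p.jointLaw π (W ⁻¹' {w}))⁻¹ * π y ≠ ∞ :=
      ENNReal.mul_ne_top (ENNReal.inv_ne_top.mpr hnull) (PMF.apply_ne_top _ _)
    rw [cond_apply hWm, e2, cond_apply hWm _ ({y} ×ˢ Set.univ), e1,
      jointLaw_singleton_prod, jointLaw_singleton_prod, measure_univ, mul_one, ← mul_assoc,
      mul_comm _ (_ * π y)] at this
    exact (ENNReal.mul_right_inj hne hnt).mp this
  refine Measure.ext fun A hA => ?_
  rw [Measure.map_apply (p.measurable_messages _) hA, Measure.map_apply (p.measurable_messages _) hA,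
    key x rfl A hA, key x' hx.symm A hA]

theorem histogram_comp_perm {x : Fin n → Fin d} (σ : Equiv.Perm (Fin n)) :
    histogram ∅ (x ∘ σ) = histogram ∅ x := by
  simp only [histogram, Finset.compl_empty]
  exact Equiv.sum_comp σ fun i => (Pi.single (x i) 1 : Fin d → ℕ)

/-- Under `S1` the messages of all users but `j` are independent of the data: with the message of
user `j` overwritten, the law of the messages does not depend on the data. -/
theorem S1.map_update_messages_eq (h : p.S1) (j : Fin n) (v : p.Msg j) (x x' : Fin n → Fin d) :
    p.seedLaw.map (fun θ => Function.update (p.messages x θ) j v) =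
      p.seedLaw.map (fun θ => Function.update (p.messages x' θ) j v) := by
  classical
  have hm : Measurable fun y : ∀ i, p.Msg i => Function.update y j v := measurable_of_countable _
  have hcongr : ∀ y y' : Fin n → Fin d, histogram ∅ y = histogram ∅ y' →
      p.seedLaw.map (fun θ => Function.update (p.messages y θ) j v) =
        p.seedLaw.map (fun θ => Function.update (p.messages y' θ) j v) := by
    intro y y' hy
    have := congrArg (fun m => m.map fun z : ∀ i, p.Msg i => Function.update z j v)
      (h.map_messages_eq hy)
    simpa only [Measure.map_map hm (p.measurable_messages _), Function.comp_def] using this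
  have hj : ∀ (y : Fin n → Fin d) (a : Fin d),
      (fun θ => Function.update (p.messages (Function.update y j a) θ) j v) =
        fun θ => Function.update (p.messages y θ) j v := by
    intro y a
    funext θ i
    by_cases hi : i = j
    · subst hi; simp
    · simp [hi, messages]
  have step : ∀ (y : Fin n → Fin d) (i : Fin n) (a : Fin d),
      p.seedLaw.map (fun θ => Function.update (p.messages (Function.update y i a) θ) j v) =
        p.seedLaw.map (fun θ => Function.update (p.messages y θ) j v) := by
    intro y i a
    rcases eq_or_ne i j with rfl | hij
    · rw [hj]
    -- The masked user `j` may hold any item: give `j` the item `a` before the change at `i`, and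
    -- the old item `y i` after it. The two inputs then differ by the transposition of `i` and `j`.
    rw [← hj y a, ← hj (Function.update y i a) (y i)]
    refine hcongr _ _ ?_
    rw [← histogram_comp_perm (Equiv.swap i j)]
    congr 1
    funext k
    simp only [Function.comp, Function.update_apply, Equiv.swap_apply_def]
    split_ifs <;> simp_all
  have all : ∀ s : Finset (Fin n),
      p.seedLaw.map (fun θ => Function.update (p.messages (s.piecewise x' x) θ) j v) =
        p.seedLaw.map (fun θ => Function.update (p.messages x θ) j v) := by
    intro s
    induction s using Finset.induction_on with
    | empty => simp
    | insert i s _ ih => rw [Finset.piecewise_insert, step, ih]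
  simpa using (all Finset.univ).symm

theorem jointLaw_map_uniform_apply {T : Type*} [Fintype T] [Nonempty T] (X : T → Fin n → Fin d)
    {E : Set ((Fin n → Fin d) × (∀ i, p.Seed i))} (hE : MeasurableSet E) :
    p.jointLaw ((PMF.uniformOfFintype T).map X) E =
      (∑ t, p.seedLaw (Prod.mk (X t) ⁻¹' E)) / Fintype.card T := by
  classical
  let _ : MeasurableSpace T := ⊤
  rw [jointLaw, Measure.prod_apply hE, ← PMF.toMeasure_map _ _ (measurable_from_top),
    lintegral_map (measurable_of_countable _) measurable_from_top, lintegral_fintype]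
  simp only [PMF.toMeasure_apply_singleton _ _ (measurableSet_singleton _),
    PMF.uniformOfFintype_apply]
  rw [← Finset.sum_mul, div_eq_mul_inv]

/-- The entropy of the message of a single user is bounded below by means of list decoding: the
message of user `j` has to carry all the information about the data, since the other messages
are independent of them. -/
theorem S1.mul_le_commCost {T : Type*} [Fintype T] [Nonempty T] (h : p.S1) (j : Fin n)
    (X : T → Fin n → Fin d) {loss : T → (Fin d → ℝ) → ℝ≥0∞}
    {η : ℝ≥0∞} (hη : ∀ t, ∫⁻ θ, loss t (p.output (X t) θ) ∂p.seedLaw ≤ η)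
    {B : ℝ≥0∞} (hB : ∀ z, ∑ t, (1 - loss t z) ≤ B) {L : ℝ} (hL : 1 ≤ L) {N : ℕ}
    (hN : L < N + 1) :
    ENNReal.ofReal (Real.logb 2 L) * (1 - η - N * B / Fintype.card T) ≤ p.commCost j := by
  classical
  obtain ⟨f, hf⟩ := p.exists_output_eq_comp_messages
  set π := (PMF.uniformOfFintype T).map X with hπ
  have hV : Measurable fun ω : (Fin n → Fin d) × (∀ i, p.Seed i) =>
      p.encode j (ω.1 j) (ω.2 j) := by
    refine measurable_from_prod_countable_right fun x => ?_
    exact (p.measurable_encode j (x j)).comp (measurable_pi_apply j)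
  have : IsProbabilityMeasure
      ((p.jointLaw π).map fun ω => p.encode j (ω.1 j) (ω.2 j)) :=
    Measure.isProbabilityMeasure_map hV.aemeasurable
  obtain ⟨A, hA, hent⟩ := exists_finset_logb_mul_measure_compl_le_entropy
    ((p.jointLaw π).map fun ω => p.encode j (ω.1 j) (ω.2 j)) hL hN
  refine le_trans (le_trans ?_ hent)
    (le_iSup (fun π => entropyBits (p.jointLaw π) (fun ω => p.encode j (ω.1 j) (ω.2 j))) π)
  gcongr
  rw [Measure.map_apply hV MeasurableSet.of_discrete,
    jointLaw_map_uniform_apply X (hV MeasurableSet.of_discrete)]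
  set b : T → ℝ≥0∞ := fun t => p.seedLaw (Prod.mk (X t) ⁻¹'
    ((fun ω : (Fin n → Fin d) × (∀ i, p.Seed i) => p.encode j (ω.1 j) (ω.2 j)) ⁻¹' (↑A)ᶜ)) with hb
  have hbm : ∀ t, MeasurableSet (Prod.mk (X t) ⁻¹'
    ((fun ω : (Fin n → Fin d) × (∀ i, p.Seed i) => p.encode j (ω.1 j) (ω.2 j)) ⁻¹'
      ((A : Set (p.Msg j)))ᶜ)) := fun t => measurable_prodMk_left (hV MeasurableSet.of_discrete)
  have hM0 : (Fintype.card T : ℝ≥0∞) ≠ 0 := by simp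
  have hMt : (Fintype.card T : ℝ≥0∞) ≠ ∞ := by simp
  -- The score of an output, truncated at zero. The message space is countable, so no measurability
  -- of `loss` is needed.
  set s : T → (∀ i, p.Msg i) → ℝ≥0∞ := fun t y => 1 - loss t (f y) with hs
  have hsm : ∀ t, Measurable (s t) := fun t => measurable_of_countable _
  have hupd : ∀ t (v : p.Msg j),
      Measurable fun θ => Function.update (p.messages (X t) θ) j v := fun t v =>
    (measurable_of_countable fun y : ∀ i, p.Msg i => Function.update y j v).comp
      (p.measurable_messages _)
  have hsU : ∀ t (v : p.Msg j),
      Measurable fun θ => s t (Function.update (p.messages (X t) θ) j v) := fun t v =>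
    (hsm t).comp (hupd t v)
  have h1 : ∀ t, 1 ≤ ∫⁻ θ, s t (p.messages (X t) θ) ∂p.seedLaw + η := by
    intro t
    calc (1 : ℝ≥0∞) = ∫⁻ _, 1 ∂p.seedLaw := by simp
      _ ≤ ∫⁻ θ, s t (p.messages (X t) θ) + loss t (p.output (X t) θ) ∂p.seedLaw := by
        refine lintegral_mono fun θ => ?_
        simp only [hs, hf]
        exact le_tsub_add
      _ = ∫⁻ θ, s t (p.messages (X t) θ) ∂p.seedLaw +
          ∫⁻ θ, loss t (p.output (X t) θ) ∂p.seedLaw :=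
        lintegral_add_left ((hsm t).comp (p.measurable_messages _)) _
      _ ≤ _ := by gcongr; exact hη t
  have h2 : ∀ t, ∫⁻ θ, s t (p.messages (X t) θ) ∂p.seedLaw ≤
      b t + ∑ v ∈ A, ∫⁻ θ, s t (Function.update (p.messages (X t) θ) j v) ∂p.seedLaw := by
    intro t
    simp only [hb]
    rw [← lintegral_finsetSum _ fun v _ => hsU t v,
      ← lintegral_indicator_one (hbm t), ← lintegral_add_left (measurable_one.indicator (hbm t))]
    refine lintegral_mono fun θ => ?_
    -- Either the message is off the list, or overwriting it with its own value, which is one of the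
    -- guesses, changes nothing.
    by_cases hv : p.messages (X t) θ j ∈ A
    · calc s t (p.messages (X t) θ) =
          s t (Function.update (p.messages (X t) θ) j (p.messages (X t) θ j)) := by
            rw [Function.update_eq_self]
        _ ≤ ∑ v ∈ A, s t (Function.update (p.messages (X t) θ) j v) :=
          Finset.single_le_sum (f := fun v => s t (Function.update (p.messages (X t) θ) j v))
            (fun _ _ => zero_le) hv
        _ ≤ _ := le_add_self
    · refine le_trans ?_ le_self_add
      rw [Set.indicator_of_mem (by simpa [messages] using hv)]
      exact tsub_le_self
  have h3 : ∑ t, ∑ v ∈ A, ∫⁻ θ, s t (Function.update (p.messages (X t) θ) j v) ∂p.seedLaw ≤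
      N * B := by
    obtain ⟨t₀⟩ := ‹Nonempty T›
    rw [Finset.sum_comm]
    calc _ ≤ ∑ v ∈ A, B := by
          refine Finset.sum_le_sum fun v _ => ?_
          -- The masked law is the same for all `t`, so the sum over `t` moves inside one integral,
          -- where `hB` bounds it pointwise.
          have : ∀ t, ∫⁻ θ, s t (Function.update (p.messages (X t) θ) j v) ∂p.seedLaw =
              ∫⁻ y, s t y ∂(p.seedLaw.map
                fun θ => Function.update (p.messages (X t₀) θ) j v) := by
            intro t
            rw [← h.map_update_messages_eq j v (X t) (X t₀),
              lintegral_map (hsm t) (hupd t v)]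
          simp only [this]
          rw [← lintegral_finsetSum _ fun t _ => hsm t]
          have : IsProbabilityMeasure (p.seedLaw.map
              fun θ => Function.update (p.messages (X t₀) θ) j v) :=
            Measure.isProbabilityMeasure_map (hupd t₀ v).aemeasurable
          calc _ ≤ ∫⁻ _, B ∂(p.seedLaw.map
              fun θ => Function.update (p.messages (X t₀) θ) j v) :=
                lintegral_mono fun y => hB (f y)
            _ = B := by simp
      _ = A.card * B := by simp
      _ ≤ N * B := by gcongr
  have h4 : (Fintype.card T : ℝ≥0∞) ≤ Fintype.card T * η + N * B + ∑ t, b t := by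
    calc (Fintype.card T : ℝ≥0∞) = ∑ _t : T, (1 : ℝ≥0∞) := by simp
      _ ≤ ∑ t, (b t + ∑ v ∈ A, ∫⁻ θ, s t (Function.update (p.messages (X t) θ) j v) ∂p.seedLaw
            + η) := Finset.sum_le_sum fun t _ => (h1 t).trans (by gcongr; exact h2 t)
      _ = ∑ t, b t + ∑ t, ∑ v ∈ A, ∫⁻ θ, s t (Function.update (p.messages (X t) θ) j v) ∂p.seedLaw
            + Fintype.card T * η := by simp [Finset.sum_add_distrib]
      _ ≤ ∑ t, b t + N * B + Fintype.card T * η := by gcongr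
      _ = _ := by ring
  rw [tsub_tsub, tsub_le_iff_left, ← ENNReal.mul_le_mul_iff_right hM0 hMt, mul_one, mul_add, mul_add,
    ENNReal.mul_div_cancel hM0 hMt, ENNReal.mul_div_cancel hM0 hMt]
  exact h4

end AggregationProtocol

/-! ### Block inputs, their separation, and Hamming balls -/

theorem histogram_empty_apply {n d : ℕ} (x : Fin n → Fin d) (a : Fin d) :
    histogram ∅ x a = (Finset.univ.filter fun i => x i = a).card := by
  simp [histogram, Finset.sum_apply, Pi.single_apply, eq_comm]

/-- The `v`-th item of the `l`-th of `k` disjoint blocks of `d / k` items. -/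
def blockItem {d k : ℕ} (l : Fin k) (v : Fin (d / k)) : Fin d :=
  ⟨l * (d / k) + v, by
    calc (l : ℕ) * (d / k) + v < l * (d / k) + d / k := by omega
      _ = (l + 1) * (d / k) := by ring
      _ ≤ k * (d / k) := Nat.mul_le_mul_right _ l.2
      _ ≤ d := Nat.mul_div_le d k⟩

theorem blockItem_inj {d k : ℕ} {l l' : Fin k} {v v' : Fin (d / k)}
    (h : blockItem l v = blockItem l' v') : l = l' ∧ v = v' := by
  have h' : (l : ℕ) * (d / k) + v = l' * (d / k) + v' := by simpa [blockItem] using h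
  have hq : 0 < d / k := v.pos
  have h1 : (l : ℕ) = l' := by
    have := congrArg (· / (d / k)) h'
    simpa [mul_comm _ (d / k), Nat.mul_add_div hq, Nat.div_eq_of_lt v.2, Nat.div_eq_of_lt v'.2]
      using this
  refine ⟨Fin.ext h1, Fin.ext ?_⟩
  rw [h1] at h'
  omega

/-- The data in which the users are split evenly into `k` groups, where the users of the `l`-th
group hold the item `u l` of the `l`-th block. -/
def blockInput {n d k : ℕ} (hk : 0 < k) (u : Fin k → Fin (d / k)) (i : Fin n) : Fin d :=
  blockItem ⟨i % k, Nat.mod_lt _ hk⟩ (u ⟨i % k, Nat.mod_lt _ hk⟩)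

theorem div_le_histogram_blockInput {n d k : ℕ} (hk : 0 < k) (u : Fin k → Fin (d / k))
    (l : Fin k) : n / k ≤ histogram ∅ (blockInput (n := n) hk u) (blockItem l (u l)) := by
  rw [histogram_empty_apply]
  have hlt : ∀ r : Fin (n / k), (r : ℕ) * k + l < n := fun r => by
    calc (r : ℕ) * k + l < r * k + k := by omega
      _ = (r + 1) * k := by ring
      _ ≤ (n / k) * k := Nat.mul_le_mul_right _ r.2
      _ ≤ n := Nat.div_mul_le_self n k
  calc n / k = (Finset.univ : Finset (Fin (n / k))).card := by simp
    _ ≤ _ := by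
      refine Finset.card_le_card_of_injOn (fun r => ⟨(r : ℕ) * k + l, hlt r⟩) ?_ ?_
      · intro r _
        have : ((r : ℕ) * k + l) % k = l := by
          rw [Nat.mul_add_mod_self_right, Nat.mod_eq_of_lt l.2]
        have h' : blockInput hk u (⟨(r : ℕ) * k + l, hlt r⟩ : Fin n) = blockItem l (u l) := by
          simp only [blockInput, this]
        simpa using h'
      · intro r _ r' _ h
        have : (r : ℕ) * k = r' * k := by simpa using h
        exact Fin.ext (Nat.eq_of_mul_eq_mul_right hk this)

theorem histogram_blockInput_eq_zero {n d k : ℕ} (hk : 0 < k) (u : Fin k → Fin (d / k))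
    {l : Fin k} {v : Fin (d / k)} (hv : u l ≠ v) :
    histogram ∅ (blockInput (n := n) hk u) (blockItem l v) = 0 := by
  rw [histogram_empty_apply, Finset.card_eq_zero, Finset.filter_eq_empty_iff]
  intro i _ h
  obtain ⟨rfl, h2⟩ := blockItem_inj h
  exact hv h2

theorem div_le_norm_histogram_blockInput_sub {n d k : ℕ} (hk : 0 < k)
    {u u' : Fin k → Fin (d / k)} (h : u ≠ u') :
    ((n / k : ℕ) : ℝ) ≤ ‖(fun a => (histogram ∅ (blockInput (n := n) hk u) a : ℝ)) -
      fun a => (histogram ∅ (blockInput (n := n) hk u') a : ℝ)‖ := by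
  obtain ⟨l, hl⟩ := Function.ne_iff.mp h
  refine le_trans ?_ (norm_le_pi_norm _ (blockItem l (u l)))
  rw [Pi.sub_apply, histogram_blockInput_eq_zero hk u' hl.symm]
  simpa using div_le_histogram_blockInput (n := n) hk u l

/-- Each block where the words differ contributes at two distinct coordinates, the item of `u` and
that of `u'`; at each of them one histogram is at least `n / k` and the other vanishes. -/
theorem hammingDist_mul_le_sum_histogram_blockInput_sub_sq {n d k : ℕ} (hk : 0 < k)
    (u u' : Fin k → Fin (d / k)) :
    2 * (hammingDist u u' : ℝ) * ((n / k : ℕ) : ℝ) ^ 2 ≤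
      ∑ a, ((histogram ∅ (blockInput (n := n) hk u) a : ℝ) -
        histogram ∅ (blockInput (n := n) hk u') a) ^ 2 := by
  classical
  set F : Fin d → ℝ := fun a => ((histogram ∅ (blockInput (n := n) hk u) a : ℝ) -
        histogram ∅ (blockInput (n := n) hk u') a) ^ 2 with hF
  set S : Finset (Fin k) := Finset.univ.filter fun l => u l ≠ u' l with hS
  have hinj : ∀ w : Fin k → Fin (d / k), Set.InjOn (fun l => blockItem l (w l)) (S : Set (Fin k)) :=
    fun w l _ l' _ h => (blockItem_inj h).1
  have hdisj : Disjoint (S.image fun l => blockItem l (u l)) (S.image fun l => blockItem l (u' l)) := by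
    rw [Finset.disjoint_left]
    intro a ha ha'
    obtain ⟨l, hl, rfl⟩ := Finset.mem_image.mp ha
    obtain ⟨l', hl', h⟩ := Finset.mem_image.mp ha'
    obtain ⟨rfl, h2⟩ := blockItem_inj h
    exact (Finset.mem_filter.mp hl).2 h2.symm
  have h1 : ∀ l ∈ S, ((n / k : ℕ) : ℝ) ^ 2 ≤ F (blockItem l (u l)) := by
    intro l hl
    simp only [hF]
    rw [histogram_blockInput_eq_zero hk u' (Finset.mem_filter.mp hl).2.symm, Nat.cast_zero, sub_zero]
    gcongr
    exact div_le_histogram_blockInput hk u l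
  have h2 : ∀ l ∈ S, ((n / k : ℕ) : ℝ) ^ 2 ≤ F (blockItem l (u' l)) := by
    intro l hl
    simp only [hF]
    rw [histogram_blockInput_eq_zero hk u (Finset.mem_filter.mp hl).2, Nat.cast_zero, zero_sub,
      neg_sq]
    gcongr
    exact div_le_histogram_blockInput hk u' l
  calc 2 * (hammingDist u u' : ℝ) * ((n / k : ℕ) : ℝ) ^ 2
      = ∑ l ∈ S, ((n / k : ℕ) : ℝ) ^ 2 + ∑ l ∈ S, ((n / k : ℕ) : ℝ) ^ 2 := by
        simp only [Finset.sum_const, nsmul_eq_mul]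
        have : hammingDist u u' = S.card := rfl
        rw [this]; ring
    _ ≤ ∑ l ∈ S, F (blockItem l (u l)) + ∑ l ∈ S, F (blockItem l (u' l)) :=
        add_le_add (Finset.sum_le_sum h1) (Finset.sum_le_sum h2)
    _ = ∑ a ∈ (S.image fun l => blockItem l (u l)) ∪ (S.image fun l => blockItem l (u' l)), F a := by
        rw [Finset.sum_union hdisj, Finset.sum_image (hinj u), Finset.sum_image (hinj u')]
    _ ≤ ∑ a, F a :=
        Finset.sum_le_sum_of_subset_of_nonneg (Finset.subset_univ _) fun _ _ _ => sq_nonneg _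

/-- A Hamming ball of radius `k / 2` among the words of length `k` over `q` letters. -/
theorem card_two_mul_hammingDist_le {k q : ℕ} (hq : 0 < q) (u : Fin k → Fin q) :
    ((Finset.univ.filter fun u' => 2 * hammingDist u u' ≤ k).card : ℝ) ≤ (2 * √q) ^ k := by
  obtain ⟨r, hr⟩ : ∃ r : ℝ, r = √(q : ℝ) := ⟨_, rfl⟩
  have hs : 1 ≤ r := hr ▸ Real.one_le_sqrt.mpr (by exact_mod_cast hq)
  have hs0 : 0 < r := by linarith
  have hqr : q * r⁻¹ = r := by rw [hr, ← div_eq_mul_inv, Real.div_sqrt]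
  rw [← hr]
  -- Exponential weights with `r = √q`: the product over the coordinates is at least `1` on the
  -- ball, because agreements are at least as many as disagreements there. The sum over all words
  -- factorizes, each factor being at most `r + q * r⁻¹ = 2 * r`.
  obtain ⟨w, hw⟩ : ∃ w : Fin q → Fin q → ℝ, w = fun a b => if a ≠ b then r⁻¹ else r := ⟨_, rfl⟩
  have hw0 : ∀ a b, 0 ≤ w a b := fun a b => by
    rw [hw]; dsimp only; split_ifs <;> positivity
  have hball : ∀ u' : Fin k → Fin q, 2 * hammingDist u u' ≤ k → 1 ≤ ∏ l, w (u l) (u' l) := by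
    intro u' h
    simp only [hw]
    rw [Finset.prod_ite, Finset.prod_const, Finset.prod_const]
    have hc := Finset.card_filter_add_card_filter_not (s := Finset.univ)
      (fun l => u l ≠ u' l)
    rw [Finset.card_univ, Fintype.card_fin] at hc
    have hd : hammingDist u u' = (Finset.univ.filter fun l => u l ≠ u' l).card := rfl
    rw [← hd] at hc ⊢
    rw [inv_pow, inv_mul_eq_div, one_le_div (by positivity)]
    exact pow_le_pow_right₀ hs (by omega)
  have hsum : ∀ a, ∑ v, w a v ≤ 2 * r := by
    intro a
    rw [← Finset.add_sum_erase _ _ (Finset.mem_univ a), two_mul]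
    have h1 : w a a = r := by simp [hw]
    have h2 : ∑ v ∈ Finset.univ.erase a, w a v ≤ r := by
      calc _ = ∑ v ∈ Finset.univ.erase a, r⁻¹ :=
            Finset.sum_congr rfl fun v hv => by
              simp [hw, (Finset.ne_of_mem_erase hv).symm]
        _ ≤ ∑ v : Fin q, r⁻¹ :=
            Finset.sum_le_sum_of_subset_of_nonneg (Finset.subset_univ _) fun _ _ _ => by
              positivity
        _ = r := by
            rw [Finset.sum_const, Finset.card_univ, Fintype.card_fin, nsmul_eq_mul, hqr]
    rw [h1]
    gcongr
  have hprod : ∑ u' : Fin k → Fin q, ∏ l, w (u l) (u' l) = ∏ l, ∑ v, w (u l) v := by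
    rw [Finset.prod_univ_sum, Fintype.piFinset_univ]
  calc ((Finset.univ.filter fun u' => 2 * hammingDist u u' ≤ k).card : ℝ)
      = ∑ u' ∈ Finset.univ.filter (fun u' => 2 * hammingDist u u' ≤ k), (1 : ℝ) := by
        rw [Finset.sum_const, nsmul_eq_mul, mul_one]
    _ ≤ ∑ u' ∈ Finset.univ.filter (fun u' => 2 * hammingDist u u' ≤ k), ∏ l, w (u l) (u' l) :=
        Finset.sum_le_sum fun u' hu' => hball u' (Finset.mem_filter.mp hu').2
    _ ≤ ∑ u' : Fin k → Fin q, ∏ l, w (u l) (u' l) :=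
        Finset.sum_le_sum_of_subset_of_nonneg (Finset.subset_univ _) fun _ _ _ =>
          Finset.prod_nonneg fun _ _ => hw0 _ _
    _ = ∏ l, ∑ v, w (u l) v := hprod
    _ ≤ ∏ _l : Fin k, (2 * r) :=
        Finset.prod_le_prod (fun _ _ => Finset.sum_nonneg fun _ _ => hw0 _ _) fun l _ => hsum (u l)
    _ = (2 * r) ^ k := by rw [Finset.prod_const, Finset.card_univ, Fintype.card_fin]

/-- Fixes the list size so that `L` Hamming balls cover at most a quarter of all words. The
threshold `4096 = 2 ^ 12` is what the last estimate needs for `k = 1`. -/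
theorem exists_mul_log_le_logb {k q : ℕ} (hk : 0 < k) (hq : 4096 ≤ q) :
    ∃ L : ℝ, 1 ≤ L ∧ 4 * (L * (2 * √q) ^ k) = (q : ℝ) ^ k ∧
      k / 4 * Real.log q ≤ Real.logb 2 L := by
  have hqr : (4096 : ℝ) ≤ q := by exact_mod_cast hq
  have hs : 64 ≤ √(q : ℝ) := by
    rw [Real.le_sqrt (by norm_num) (by positivity)]; linarith
  have hsq : √(q : ℝ) ^ 2 = q := Real.sq_sqrt (by positivity)
  set L : ℝ := (√q / 2) ^ k / 4 with hLdef
  have hL : 1 ≤ L := by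
    rw [hLdef, le_div_iff₀ (by norm_num)]
    calc (1 : ℝ) * 4 ≤ √q / 2 := by linarith
      _ ≤ (√q / 2) ^ k := le_self_pow₀ (by linarith) hk.ne'
  refine ⟨L, hL, ?_, ?_⟩
  · rw [hLdef]
    calc 4 * ((√q / 2) ^ k / 4 * (2 * √q) ^ k) = (√q / 2) ^ k * (2 * √(q : ℝ)) ^ k := by ring
      _ = (√(q : ℝ) ^ 2) ^ k := by rw [← mul_pow]; congr 1; ring
      _ = q ^ k := by rw [hsq]
  · have hlog2 : 0 < Real.log 2 := Real.log_pos one_lt_two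
    have hlq : 12 * Real.log 2 ≤ Real.log q := by
      calc 12 * Real.log 2 = Real.log ((2 : ℝ) ^ 12) := by rw [Real.log_pow]; norm_num
        _ ≤ Real.log q := Real.log_le_log (by norm_num) (by linarith)
    have hlL : Real.log L = k * (Real.log q / 2 - Real.log 2) - 2 * Real.log 2 := by
      have h4 : Real.log 4 = 2 * Real.log 2 := by
        rw [show (4 : ℝ) = 2 ^ 2 by norm_num, Real.log_pow]; norm_num
      rw [hLdef, Real.log_div (by positivity) (by norm_num), Real.log_pow,
        Real.log_div (by positivity) (by norm_num), Real.log_sqrt (by positivity), h4]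
    have hk1 : (1 : ℝ) ≤ k := by exact_mod_cast hk
    have hLle : Real.log L ≤ Real.logb 2 L := by
      rw [Real.logb, le_div_iff₀ hlog2]
      exact mul_le_of_le_one_right (Real.log_nonneg hL) (by linarith [Real.log_two_lt_d9])
    refine le_trans ?_ hLle
    rw [hlL]
    nlinarith

theorem lintegral_ofReal_div_le {Ω : Type*} [MeasurableSpace Ω] {μ : Measure Ω} {f : Ω → ℝ}
    {a s : ℝ} (hs : 0 < s) (h : ∫⁻ ω, ENNReal.ofReal (f ω) ∂μ ≤ ENNReal.ofReal a) :
    ∫⁻ ω, ENNReal.ofReal (f ω / s) ∂μ ≤ ENNReal.ofReal (a / s) := by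
  simp only [ENNReal.ofReal_div_of_pos hs]
  simp only [div_eq_mul_inv]
  rw [lintegral_mul_const' _ _ (by simpa using hs)]
  gcongr

/-! ### From decodability to communication -/

namespace AggregationProtocol

variable {n d : ℕ} {p : AggregationProtocol.{u} n d}

/-- An estimate that discriminates between two inputs forces every message to carry a constant
amount of information. -/
theorem S1.le_commCost_of_two_inputs (h : p.S1) (j : Fin n) (X : Bool → Fin n → Fin d)
    {ρ : Bool → (Fin d → ℝ) → ℝ} {τ : ℝ} (hτ : 0 < τ) (hρ0 : ∀ b z, 0 ≤ ρ b z)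
    (herr : ∀ b, ∫⁻ θ, ENNReal.ofReal (ρ b (p.output (X b) θ)) ∂p.seedLaw ≤
      ENNReal.ofReal (τ / 4)) (hsep : ∀ z, τ ≤ ρ true z + ρ false z) :
    ENNReal.ofReal (1 / 8) ≤ p.commCost j := by
  have key := h.mul_le_commCost j X (loss := fun b z => ENNReal.ofReal (ρ b z / τ))
    -- With `L < 2` the list has at most one element. Separation bounds the two scores by `1` in
    -- total, which leaves `1 - 1/4 - 1/2 = 1/4`, and `logb 2 (3/2) ≥ 1/2` gives `1/8`.
    (η := ENNReal.ofReal (1 / 4)) (B := 1) (L := 3 / 2) (N := 1)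
    (fun b => by
      refine (lintegral_ofReal_div_le hτ (herr b)).trans_eq ?_
      congr 1; field_simp)
    (fun z => by
      have h1 : (1 : ℝ≥0∞) = ENNReal.ofReal 1 := by simp
      rw [Fintype.sum_bool, h1, ← ENNReal.ofReal_sub _ (div_nonneg (hρ0 _ _) hτ.le),
        ← ENNReal.ofReal_sub _ (div_nonneg (hρ0 _ _) hτ.le)]
      have h2 : 1 ≤ ρ true z / τ + ρ false z / τ := by
        rw [← add_div, one_le_div hτ]; exact hsep z
      have h3 := div_nonneg (hρ0 true z) hτ.le
      have h4 := div_nonneg (hρ0 false z) hτ.le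
      rcases le_total (ρ true z / τ) 1 with h5 | h5
      · rcases le_total (ρ false z / τ) 1 with h6 | h6
        · rw [← ENNReal.ofReal_add (by linarith) (by linarith)]
          exact ENNReal.ofReal_le_ofReal (by linarith)
        · rw [ENNReal.ofReal_of_nonpos (p := 1 - ρ false z / τ) (by linarith), add_zero]
          exact ENNReal.ofReal_le_ofReal (by linarith)
      · rw [ENNReal.ofReal_of_nonpos (p := 1 - ρ true z / τ) (by linarith), zero_add]
        exact ENNReal.ofReal_le_ofReal (by linarith)) (by norm_num) (by norm_num)
  refine le_trans ?_ key
  have h1 : (1 : ℝ≥0∞) - ENNReal.ofReal (1 / 4) - (1 : ℕ) * 1 / (Fintype.card Bool : ℝ≥0∞) =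
      ENNReal.ofReal (1 / 4) := by
    have h2 : ((1 : ℕ) : ℝ≥0∞) * 1 / (Fintype.card Bool : ℝ≥0∞) = ENNReal.ofReal (1 / 2) := by
      rw [ENNReal.ofReal_div_of_pos two_pos]; simp
    rw [h2, ← ENNReal.ofReal_one, ← ENNReal.ofReal_sub _ (by norm_num),
      ← ENNReal.ofReal_sub _ (by norm_num)]
    norm_num
  have h3 : 1 / 2 ≤ Real.logb 2 (3 / 2) := by
    rw [Real.le_logb_iff_rpow_le one_lt_two (by norm_num), ← Real.sqrt_eq_rpow,
      Real.sqrt_le_left (by norm_num)]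
    norm_num
  rw [h1, ← ENNReal.ofReal_mul (by linarith)]
  exact ENNReal.ofReal_le_ofReal (by linarith)

/-- An estimate from which the items of at least half of the `k` blocks can be read off forces
every message to carry an amount of information of the order `k log (d / k)`. -/
theorem S1.le_commCost_of_blocks (h : p.S1) (j : Fin n) {k : ℕ} (hk : 0 < k)
    (hq : 4096 ≤ d / k) {ρ : (Fin k → Fin (d / k)) → (Fin d → ℝ) → ℝ} {τ : ℝ} (hτ : 0 < τ)
    (herr : ∀ u, ∫⁻ θ, ENNReal.ofReal (ρ u (p.output (blockInput hk u) θ)) ∂p.seedLaw ≤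
      ENNReal.ofReal (τ / 4))
    (hsep : ∀ z u u', ρ u z < τ / 2 → ρ u' z < τ / 2 → 2 * hammingDist u u' ≤ k) :
    ENNReal.ofReal (k / 16 * Real.log (d / k : ℕ)) ≤ p.commCost j := by
  classical
  have hq0 : 0 < d / k := by omega
  have hq1 : (0 : ℝ) < (d / k : ℕ) := by exact_mod_cast hq0
  have : Nonempty (Fin (d / k)) := ⟨⟨0, hq0⟩⟩
  obtain ⟨L, hL, hLB, h3⟩ := exists_mul_log_le_logb hk hq
  set B : ℝ := (2 * √(d / k : ℕ)) ^ k with hB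
  have hB0 : 0 < B := by positivity
  have key := h.mul_le_commCost j (blockInput hk)
    -- Scores are positive only where `ρ u z < τ / 2`. Such words lie in a Hamming ball around any
    -- one of them. The remaining mass is `1 - 1/2 - 1/4 = 1/4`.
    (loss := fun u z => ENNReal.ofReal (ρ u z / (τ / 2)))
    (η := ENNReal.ofReal (1 / 2)) (B := ENNReal.ofReal B) (L := L) (N := ⌊L⌋₊)
    (fun b => by
      refine (lintegral_ofReal_div_le (half_pos hτ) (herr b)).trans_eq ?_
      congr 1; field_simp; norm_num)
    (fun z => by
      have hpos : ∀ u, 1 - ENNReal.ofReal (ρ u z / (τ / 2)) ≤ if ρ u z < τ / 2 then 1 else 0 := by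
        intro u
        split_ifs with hu
        · exact tsub_le_self
        · rw [nonpos_iff_eq_zero, tsub_eq_zero_iff_le, ENNReal.one_le_ofReal,
            one_le_div (half_pos hτ)]
          exact not_lt.mp hu
      refine (Finset.sum_le_sum fun u _ => hpos u).trans ?_
      rw [Finset.sum_boole]
      rcases (Finset.univ.filter fun u => ρ u z < τ / 2).eq_empty_or_nonempty with he | ⟨u, hu⟩
      · simp [he]
      · rw [← ENNReal.ofReal_natCast]
        refine ENNReal.ofReal_le_ofReal (le_trans ?_ (card_two_mul_hammingDist_le hq0 u))
        refine Nat.cast_le.mpr (Finset.card_le_card fun u' hu' => ?_)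
        exact Finset.mem_filter.mpr ⟨Finset.mem_univ _,
          hsep z u u' (Finset.mem_filter.mp hu).2 (Finset.mem_filter.mp hu').2⟩)
    hL (Nat.lt_floor_add_one L)
  refine le_trans ?_ key
  have hcard : (0 : ℝ) < (Fintype.card (Fin k → Fin (d / k)) : ℝ) := by
    exact_mod_cast Fintype.card_pos
  have h1 : ENNReal.ofReal (1 / 4) ≤ 1 - ENNReal.ofReal (1 / 2) -
      (⌊L⌋₊ : ℝ≥0∞) * ENNReal.ofReal B / (Fintype.card (Fin k → Fin (d / k)) : ℝ≥0∞) := by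
    have h2 : (⌊L⌋₊ : ℝ≥0∞) * ENNReal.ofReal B / (Fintype.card (Fin k → Fin (d / k)) : ℝ≥0∞) ≤
        ENNReal.ofReal (1 / 4) := by
      rw [← ENNReal.ofReal_natCast, ← ENNReal.ofReal_natCast, ← ENNReal.ofReal_mul (by positivity),
        ← ENNReal.ofReal_div_of_pos hcard]
      refine ENNReal.ofReal_le_ofReal ?_
      rw [div_le_iff₀ hcard]
      have : (⌊L⌋₊ : ℝ) * B ≤ L * B := by gcongr; exact Nat.floor_le (by linarith)
      simp only [Fintype.card_fun, Fintype.card_fin, Nat.cast_pow]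
      linarith
    calc ENNReal.ofReal (1 / 4) = 1 - ENNReal.ofReal (1 / 2) - ENNReal.ofReal (1 / 4) := by
          rw [← ENNReal.ofReal_one, ← ENNReal.ofReal_sub _ (by norm_num),
            ← ENNReal.ofReal_sub _ (by norm_num)]
          norm_num
      _ ≤ _ := by gcongr
  calc ENNReal.ofReal (k / 16 * Real.log (d / k : ℕ)) ≤ ENNReal.ofReal (Real.logb 2 L * (1 / 4)) :=
        ENNReal.ofReal_le_ofReal (by linarith)
    _ = ENNReal.ofReal (Real.logb 2 L) * ENNReal.ofReal (1 / 4) :=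
        ENNReal.ofReal_mul (Real.logb_nonneg one_lt_two hL)
    _ ≤ _ := by gcongr

end AggregationProtocol

/-! ### Choosing the number of blocks -/

/-- Lower bounds of order `log d` and `k log (d / k)` for `k ≤ min x n` combine to a lower bound of
order `log d * min x n` when `d` is polynomially larger than `n`. -/
theorem exists_ofReal_log_mul_min_le {κ K : ℝ} (hκ : 0 < κ) (hK : 0 < K) :
    ∃ c : ℝ, 0 < c ∧ ∀ (n d : ℕ) (x : ℝ) (H : ℝ≥0∞), 1 ≤ n → 2 ≤ d →
      (n : ℝ) ^ (1 + κ) ≤ d → 0 ≤ x →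
      ENNReal.ofReal (1 / 100 * Real.log d) ≤ H →
      (∀ k : ℕ, 0 < k → k ≤ n → (k : ℝ) ≤ x → 4096 ≤ d / k →
        ENNReal.ofReal (k / 16 * Real.log (d / k : ℕ)) ≤ H) →
      ENNReal.ofReal (c * (Real.log d * min (K * x) n)) ≤ H := by
  set κ' := κ / (1 + κ) with hκ'
  have hκ0 : 0 < κ' := by positivity
  -- Chosen so that `d ≥ d₀` forces `d ^ (κ' / 2) ≥ 8192`; smaller `d`, and `x < 1`, are absorbed
  -- into the constant by `h1`.
  set d₀ : ℝ := (8192 : ℝ) ^ (2 / κ') with hd₀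
  have hd₀0 : 0 < d₀ := by positivity
  refine ⟨min (min (1 / (100 * K)) (1 / (100 * d₀))) (κ' / (64 * (K + 1))), by positivity, ?_⟩
  intro n d x H hn hd hnd hx h1 h2
  set c := min (min (1 / (100 * K)) (1 / (100 * d₀))) (κ' / (64 * (K + 1))) with hc
  have hc0 : 0 < c := by positivity
  have hcK : c * K ≤ 1 / 100 := by
    calc c * K ≤ 1 / (100 * K) * K := by
          gcongr; exact (min_le_left _ _).trans (min_le_left _ _)
      _ = 1 / 100 := by field_simp
  have hcd : c * d₀ ≤ 1 / 100 := by
    calc c * d₀ ≤ 1 / (100 * d₀) * d₀ := by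
          gcongr; exact (min_le_left _ _).trans (min_le_right _ _)
      _ = 1 / 100 := by field_simp
  have hcκ : c * (K + 1) ≤ κ' / 64 := by
    calc c * (K + 1) ≤ κ' / (64 * (K + 1)) * (K + 1) := by gcongr; exact min_le_right _ _
      _ = κ' / 64 := by field_simp
  have hn1 : (1 : ℝ) ≤ n := by exact_mod_cast hn
  have hdr : (2 : ℝ) ≤ d := by exact_mod_cast hd
  have hlog : 0 ≤ Real.log d := Real.log_nonneg (by linarith)
  have hnd1 : (n : ℝ) ≤ d := by
    refine le_trans ?_ hnd
    calc (n : ℝ) = (n : ℝ) ^ (1 : ℝ) := (Real.rpow_one _).symm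
      _ ≤ (n : ℝ) ^ (1 + κ) := Real.rpow_le_rpow_of_exponent_le hn1 (by linarith)
  rcases lt_or_ge x 1 with hx1 | hx1
  · refine le_trans (ENNReal.ofReal_le_ofReal ?_) h1
    calc c * (Real.log d * min (K * x) n) ≤ c * (Real.log d * K) := by
          gcongr
          exact (min_le_left _ _).trans (mul_le_of_le_one_right hK.le hx1.le)
      _ = (c * K) * Real.log d := by ring
      _ ≤ 1 / 100 * Real.log d := by gcongr
  rcases lt_or_ge (d : ℝ) d₀ with hdd | hdd
  · refine le_trans (ENNReal.ofReal_le_ofReal ?_) h1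
    calc c * (Real.log d * min (K * x) n) ≤ c * (Real.log d * d₀) := by
          gcongr
          exact (min_le_right _ _).trans (hnd1.trans hdd.le)
      _ = (c * d₀) * Real.log d := by ring
      _ ≤ 1 / 100 * Real.log d := by gcongr
  set y := min x (n : ℝ) with hy
  have hy1 : 1 ≤ y := le_min hx1 hn1
  set k := ⌊y⌋₊ with hk
  have hk0 : 0 < k := Nat.floor_pos.mpr hy1
  have hky : (k : ℝ) ≤ y := Nat.floor_le (by linarith)
  have hyk : y ≤ 2 * k := by
    have := Nat.lt_floor_add_one y
    have hk1 : (1 : ℝ) ≤ k := by exact_mod_cast hk0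
    rw [← hk] at this
    linarith
  have hkn : (k : ℝ) ≤ n := hky.trans (min_le_right _ _)
  set s : ℝ := (d : ℝ) ^ (κ' / 2) with hs
  have hd0 : (0 : ℝ) < d := by linarith
  have hs1 : 8192 ≤ s := by
    calc (8192 : ℝ) = d₀ ^ (κ' / 2) := by
          rw [hd₀, ← Real.rpow_mul (by norm_num)]
          have : 2 / κ' * (κ' / 2) = 1 := by field_simp
          rw [this, Real.rpow_one]
      _ ≤ s := Real.rpow_le_rpow hd₀0.le hdd (by positivity)
  have hs2 : s ^ 2 * (k : ℝ) ≤ (d : ℝ) := by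
    have hnr : (n : ℝ) ≤ (d : ℝ) ^ (1 - κ') := by
      have : (1 : ℝ) - κ' = (1 + κ)⁻¹ := by rw [hκ']; field_simp; ring
      rw [this, Real.le_rpow_inv_iff_of_pos (by positivity) hd0.le (by linarith)]
      exact hnd
    -- Since `s ^ 2 = d ^ κ'`, this says `d / k ≥ d ^ κ'`. Keeping only the square root `s` leaves
    -- room for the integer division below.
    calc s ^ 2 * (k : ℝ) ≤ s ^ 2 * (d : ℝ) ^ (1 - κ') := by gcongr; exact hkn.trans hnr
      _ = (d : ℝ) := by
        rw [hs, ← Real.rpow_natCast, ← Real.rpow_mul hd0.le, ← Real.rpow_add hd0]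
        norm_num
  have hsq : s ≤ (d / k : ℕ) := by
    have hk0' : (0 : ℝ) < k := by exact_mod_cast hk0
    have h3 : (d : ℝ) / k < (d / k : ℕ) + 1 := by
      rw [← Nat.floor_div_eq_div (K := ℝ)]
      exact Nat.lt_floor_add_one _
    have h4 : s ^ 2 ≤ d / k := by rwa [le_div_iff₀ hk0']
    nlinarith
  have hq : 4096 ≤ d / k := by
    have : ((4096 : ℕ) : ℝ) ≤ (d / k : ℕ) := by push_cast at hsq ⊢; linarith
    exact_mod_cast this
  refine le_trans (ENNReal.ofReal_le_ofReal ?_)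
    (h2 k hk0 (by exact_mod_cast hkn) (hky.trans (min_le_left _ _)) hq)
  have hlogq : κ' / 2 * Real.log d ≤ Real.log (d / k : ℕ) := by
    rw [← Real.log_rpow hd0]
    exact Real.log_le_log (by linarith) hsq
  have hmin : min (K * x) n ≤ (K + 1) * (2 * k) := by
    refine le_trans ?_ (mul_le_mul_of_nonneg_left hyk (by linarith))
    rcases le_total x n with hxn | hxn
    · rw [hy, min_eq_left hxn]
      exact (min_le_left _ _).trans (by nlinarith)
    · rw [hy, min_eq_right hxn]
      exact (min_le_right _ _).trans (by nlinarith)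
  calc c * (Real.log d * min (K * x) n) ≤ c * (Real.log d * ((K + 1) * (2 * k))) := by gcongr
    _ = (c * (K + 1)) * (2 * k * Real.log d) := by ring
    _ ≤ κ' / 64 * (2 * k * Real.log d) := by gcongr
    _ = k / 16 * (κ' / 2 * Real.log d) := by ring
    _ ≤ k / 16 * Real.log (d / k : ℕ) := by gcongr

/-- For `d < 4096` the logarithm is at most `12 * log 2 < 12.5`, so the constant bound `1 / 8` is
enough; otherwise the one-block bound applies. -/
theorem ofReal_log_div_le {d : ℕ} {H : ℝ≥0∞} (hd : 2 ≤ d) (h1 : ENNReal.ofReal (1 / 8) ≤ H)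
    (h2 : 4096 ≤ d / 1 → ENNReal.ofReal ((1 : ℕ) / 16 * Real.log (d / 1 : ℕ)) ≤ H) :
    ENNReal.ofReal (1 / 100 * Real.log d) ≤ H := by
  have hd0 : (2 : ℝ) ≤ d := by exact_mod_cast hd
  rcases lt_or_ge d 4096 with h | h
  · refine le_trans (ENNReal.ofReal_le_ofReal ?_) h1
    have : Real.log d ≤ 12 * Real.log 2 := by
      calc Real.log d ≤ Real.log ((2 : ℝ) ^ 12) := by
            refine Real.log_le_log (by linarith) ?_
            have : (d : ℝ) ≤ 4096 := by exact_mod_cast h.le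
            linarith
        _ = 12 * Real.log 2 := by rw [Real.log_pow]; norm_num
    linarith [Real.log_two_lt_d9]
  · refine le_trans (ENNReal.ofReal_le_ofReal ?_) (h2 (by simpa using h))
    have := Real.log_nonneg (by linarith : (1 : ℝ) ≤ d)
    simp only [Nat.cast_one, Nat.div_one]
    linarith

theorem histogram_const_apply {n d : ℕ} (a b : Fin d) :
    histogram ∅ (fun _ : Fin n => a) b = if a = b then n else 0 := by
  rw [histogram_empty_apply]
  split_ifs with h <;> simp [h]

theorem natCast_le_two_mul_mul_div {n k : ℕ} (hk : 0 < k) (hkn : k ≤ n) :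
    (n : ℝ) ≤ 2 * k * (n / k : ℕ) := by
  have h1 : 1 ≤ n / k := (Nat.one_le_div_iff hk).mpr hkn
  have h2 : n ≤ 2 * k * (n / k) := by
    have h3 := Nat.div_add_mod n k
    have h4 := Nat.mod_lt n hk
    nlinarith
  exact_mod_cast h2

/-! ### The two losses -/

namespace AggregationProtocol

variable {n d : ℕ} {p : AggregationProtocol.{u} n d}

theorem LInftyErrorLE.mono {b b' : ℝ} (h : p.LInftyErrorLE b) (hb : b ≤ b') :
    p.LInftyErrorLE b' := fun x => (h x).trans (ENNReal.ofReal_le_ofReal hb)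

theorem L2SqErrorLE.mono {b b' : ℝ} (h : p.L2SqErrorLE b) (hb : b ≤ b') :
    p.L2SqErrorLE b' := fun x => (h x).trans (ENNReal.ofReal_le_ofReal hb)

theorem S1.le_commCost_of_lInftyErrorLE (h : p.S1) (j : Fin n) {k : ℕ} (hk : 0 < k) (hkn : k ≤ n)
    (hq : 4096 ≤ d / k) (herr : p.LInftyErrorLE ((n / k : ℕ) / 4)) :
    ENNReal.ofReal (k / 16 * Real.log (d / k : ℕ)) ≤ p.commCost j := by
  have hm : (0 : ℝ) < (n / k : ℕ) := by exact_mod_cast Nat.div_pos hkn hk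
  refine h.le_commCost_of_blocks j hk hq
    (ρ := fun u z => ‖z - fun a => (histogram ∅ (blockInput (n := n) hk u) a : ℝ)‖) hm
    (fun u => herr _) fun z u u' hu hu' => ?_
  -- Distinct words have histograms at distance at least `n / k`, so no `z` is within half of that
  -- of both.
  have : u = u' := by
    by_contra hne
    have h1 := div_le_norm_histogram_blockInput_sub (n := n) hk hne
    have h2 := norm_sub_le_norm_sub_add_norm_sub
      (fun a => (histogram ∅ (blockInput (n := n) hk u) a : ℝ)) z
      (fun a => (histogram ∅ (blockInput (n := n) hk u') a : ℝ))
    rw [norm_sub_rev _ z] at h2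
    linarith
  simp [this]

theorem sum_sub_sq_le {ι : Type*} [Fintype ι] (z a b : ι → ℝ) :
    ∑ i, (a i - b i) ^ 2 ≤ 2 * (∑ i, (z i - a i) ^ 2 + ∑ i, (z i - b i) ^ 2) := by
  rw [← Finset.sum_add_distrib, Finset.mul_sum]
  exact Finset.sum_le_sum fun i _ => by nlinarith [sq_nonneg ((z i - a i) + (z i - b i))]

/-- If both squared errors are below `τ / 2`, then twice the Hamming distance is strictly below `k +
1`, hence at most `k`. Using `k + 1` rather than `k` makes the permitted error for `k = 1` exactly
`n ^ 2 / 4`. -/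
theorem S1.le_commCost_of_l2SqErrorLE (h : p.S1) (j : Fin n) {k : ℕ} (hk : 0 < k) (hkn : k ≤ n)
    (hq : 4096 ≤ d / k) (herr : p.L2SqErrorLE ((k + 1) / 8 * ((n / k : ℕ) : ℝ) ^ 2)) :
    ENNReal.ofReal (k / 16 * Real.log (d / k : ℕ)) ≤ p.commCost j := by
  have hm : (0 : ℝ) < (n / k : ℕ) := by exact_mod_cast Nat.div_pos hkn hk
  refine h.le_commCost_of_blocks j hk hq
    (ρ := fun u z => ∑ a, (z a - (histogram ∅ (blockInput (n := n) hk u) a : ℝ)) ^ 2)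
    (τ := (k + 1) / 2 * ((n / k : ℕ) : ℝ) ^ 2) (by positivity)
    (fun u => (herr _).trans_eq (by congr 1; ring)) fun z u u' hu hu' => ?_
  have h1 := hammingDist_mul_le_sum_histogram_blockInput_sub_sq (n := n) hk u u'
  have h2 := h1.trans (sum_sub_sq_le z _ _)
  have h3 : (2 * (hammingDist u u' : ℝ)) * ((n / k : ℕ) : ℝ) ^ 2 <
      (k + 1) * ((n / k : ℕ) : ℝ) ^ 2 := by linarith
  have h4 : (2 * (hammingDist u u' : ℝ)) < k + 1 := lt_of_mul_lt_mul_right h3 (by positivity)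
  have h5 : 2 * hammingDist u u' < k + 1 := by exact_mod_cast h4
  omega

theorem S1.log_le_commCost_of_lInftyErrorLE (h : p.S1) (j : Fin n) (hd : 2 ≤ d)
    (herr : p.LInftyErrorLE (n / 4)) :
    ENNReal.ofReal (1 / 100 * Real.log d) ≤ p.commCost j := by
  have hn : (0 : ℝ) < n := by exact_mod_cast j.pos
  refine ofReal_log_div_le hd ?_ fun hq => h.le_commCost_of_lInftyErrorLE j one_pos j.pos hq
    (by simpa using herr)
  let X : Bool → Fin n → Fin d := fun b _ => if b then ⟨0, by omega⟩ else ⟨1, by omega⟩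
  refine h.le_commCost_of_two_inputs j X
    (ρ := fun b z => ‖z - fun a => (histogram ∅ (X b) a : ℝ)‖) hn (fun _ _ => norm_nonneg _)
    (fun b => herr _) fun z => ?_
  have h2 := norm_sub_le_norm_sub_add_norm_sub
    (fun a => (histogram ∅ (X true) a : ℝ)) z (fun a => (histogram ∅ (X false) a : ℝ))
  rw [norm_sub_rev _ z] at h2
  refine le_trans ?_ h2
  refine le_trans ?_ (norm_le_pi_norm _ (⟨0, by omega⟩ : Fin d))
  simp [X, histogram_const_apply]

theorem S1.log_le_commCost_of_l2SqErrorLE (h : p.S1) (j : Fin n) (hd : 2 ≤ d)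
    (herr : p.L2SqErrorLE ((n : ℝ) ^ 2 / 4)) :
    ENNReal.ofReal (1 / 100 * Real.log d) ≤ p.commCost j := by
  have hn : (0 : ℝ) < n := by exact_mod_cast j.pos
  refine ofReal_log_div_le hd ?_ fun hq => h.le_commCost_of_l2SqErrorLE j one_pos j.pos hq
    (herr.mono (by simp; linarith))
  -- Two constant inputs, with histograms at squared distance `2 * n ^ 2`; the factor `2` in
  -- `sum_sub_sq_le` leaves the separation `n ^ 2`.
  let X : Bool → Fin n → Fin d := fun b _ => if b then ⟨0, by omega⟩ else ⟨1, by omega⟩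
  refine h.le_commCost_of_two_inputs j X
    (ρ := fun b z => ∑ a, (z a - (histogram ∅ (X b) a : ℝ)) ^ 2) (τ := (n : ℝ) ^ 2)
    (by positivity) (fun _ _ => Finset.sum_nonneg fun _ _ => sq_nonneg _)
    (fun b => herr _) fun z => ?_
  have h2 := sum_sub_sq_le z (fun a => (histogram ∅ (X true) a : ℝ))
    (fun a => (histogram ∅ (X false) a : ℝ))
  have h3 : 2 * (n : ℝ) ^ 2 ≤ ∑ a, ((histogram ∅ (X true) a : ℝ) - histogram ∅ (X false) a) ^ 2 := by
    have hne : (⟨0, by omega⟩ : Fin d) ≠ ⟨1, by omega⟩ := by simp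
    refine le_trans (le_of_eq ?_) (Finset.sum_le_sum_of_subset_of_nonneg
      (Finset.subset_univ {(⟨0, by omega⟩ : Fin d), ⟨1, by omega⟩}) fun _ _ _ => sq_nonneg _)
    rw [Finset.sum_pair hne]
    simp [X, histogram_const_apply]
    ring
  linarith

end AggregationProtocol

/-! ### Assembly -/

theorem mainTheorem4 (κ C : ℝ) (hκ : 0 < κ) (hC : 0 < C) :
    ∃ c : ℝ, 0 < c ∧
      ∀ (n d D : ℕ) (ε δ : ℝ) (p : AggregationProtocol.{u} n d),
        (n : ℝ) ^ (1 + κ) ≤ d → 0 < ε → 0 < δ → δ < 1 →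
        p.S1 → p.S2 D → p.CentralDP ε δ →
        -- the `ℓ_∞` loss
        (p.LInftyErrorLE (C * (√(Real.log d * Real.log (1 / δ)) / ε)) →
          p.LInftyErrorLE (n / 4) →
          ∀ i : Fin n,
            ENNReal.ofReal
                (c * (n * min (ε * √(Real.log d / Real.log (1 / δ))) (Real.log d)))
              ≤ p.commCost i) ∧
        -- the squared `ℓ_2` loss
        (p.L2SqErrorLE (C * (n * Real.log d * Real.log (1 / δ) / ε ^ 2)) →
          p.L2SqErrorLE ((n : ℝ) ^ 2 / 4) →
          ∀ i : Fin n,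
            ENNReal.ofReal (c * (n * min (ε ^ 2 / Real.log (1 / δ)) (Real.log d)))
                ≤ p.commCost i ∧
            (1 ≤ ε →
              ENNReal.ofReal (c * (n * min (ε / Real.log (1 / δ)) (Real.log d)))
                ≤ p.commCost i)) := by
  -- `8 * C` and `32 * C` come from `n / k` being at least half the real quotient: `k` blocks are
  -- allowed up to `n * ε / (8 * C * r)` with `r = √(log d * log (1 / δ))`, respectively `n * ε ^ 2
  -- / (32 * C * r ^ 2)`.
  obtain ⟨c₁, hc₁, H₁⟩ := exists_ofReal_log_mul_min_le hκ (by positivity : 0 < 8 * C)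
  obtain ⟨c₂, hc₂, H₂⟩ := exists_ofReal_log_mul_min_le hκ (by positivity : 0 < 32 * C)
  refine ⟨min c₁ c₂, by positivity, ?_⟩
  intro n d D ε δ p hnd hε hδ hδ1 hS1 _ _
  have hl : 0 < Real.log (1 / δ) := Real.log_pos (by rw [lt_div_iff₀ hδ]; linarith)
  set l := Real.log (1 / δ) with hldef
  -- Here `Real.log d = 0`, so the claimed bounds vanish.
  rcases lt_or_ge d 2 with hd | hd
  · have hlog : Real.log d = 0 := by
      interval_cases d <;> simp
    have hz : ∀ t : ℝ, 0 ≤ t →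
        ENNReal.ofReal (min c₁ c₂ * (n * min t (Real.log d))) = 0 := fun t ht => by
      rw [hlog, min_eq_right ht]; simp
    refine ⟨fun _ _ i => ?_, fun _ _ i => ⟨?_, fun _ => ?_⟩⟩
    · rw [hz _ (by positivity)]; exact zero_le
    · rw [hz _ (by positivity)]; exact zero_le
    · rw [hz _ (by positivity)]; exact zero_le
  have hdr : (2 : ℝ) ≤ d := by exact_mod_cast hd
  have hlog : 0 < Real.log d := Real.log_pos (by linarith)
  set a := Real.log d with ha
  refine ⟨fun herr herr' i => ?_, fun herr herr' i => ?_⟩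
  · have hn : (0 : ℝ) < n := by exact_mod_cast i.pos
    set r := √(a * l) with hr
    have hr0 : 0 < r := Real.sqrt_pos.mpr (by positivity)
    have hr2 : r ^ 2 = a * l := Real.sq_sqrt (by positivity)
    have hsq : √(a / l) = a / r := by
      rw [Real.sqrt_eq_iff_mul_self_eq (by positivity) (by positivity)]
      field_simp
      rw [hr2]
    have key := H₁ n d (n * ε / (8 * C * r)) (p.commCost i) i.pos hd hnd (by positivity)
      (hS1.log_le_commCost_of_lInftyErrorLE i hd herr') fun k hk hkn hkx hq =>
        hS1.le_commCost_of_lInftyErrorLE i hk hkn hq (herr.mono (by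
          have hm := natCast_le_two_mul_mul_div hk hkn
          have hk0 : (0 : ℝ) < k := by exact_mod_cast hk
          rw [le_div_iff₀ (by positivity)] at hkx
          rw [← mul_div_assoc, div_le_div_iff₀ hε (by norm_num)]
          have h1 : k * (8 * C * r) ≤ k * (2 * (n / k : ℕ) * ε) := by
            refine hkx.trans ?_
            calc n * ε ≤ (2 * k * (n / k : ℕ)) * ε := by gcongr
              _ = _ := by ring
          have h2 := le_of_mul_le_mul_left h1 hk0
          linarith))
    refine le_trans (ENNReal.ofReal_le_ofReal ?_) key
    have heq : (n : ℝ) * min (ε * √(a / l)) a = a * min (8 * C * (n * ε / (8 * C * r))) n := by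
      rw [mul_min_of_nonneg _ _ hn.le, mul_min_of_nonneg _ _ hlog.le, hsq]
      congr 1
      · field_simp
      · ring
    rw [heq]
    gcongr
    · exact min_le_left _ _
  · have hn : (0 : ℝ) < n := by exact_mod_cast i.pos
    have key := H₂ n d (n * ε ^ 2 / (32 * C * (a * l))) (p.commCost i) i.pos hd hnd (by positivity)
      (hS1.log_le_commCost_of_l2SqErrorLE i hd herr') fun k hk hkn hkx hq =>
        hS1.le_commCost_of_l2SqErrorLE i hk hkn hq (herr.mono (by
          have hm := natCast_le_two_mul_mul_div hk hkn
          have hk0 : (0 : ℝ) < k := by exact_mod_cast hk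
          rw [le_div_iff₀ (by positivity)] at hkx
          set m : ℝ := ((n / k : ℕ) : ℝ) with hmdef
          rw [← mul_div_assoc, div_le_iff₀ (by positivity)]
          have h1 : k * (32 * C * (n * (a * l))) ≤ k * (4 * k * m ^ 2 * ε ^ 2) := by
            calc k * (32 * C * (n * (a * l))) = n * (k * (32 * C * (a * l))) := by ring
              _ ≤ n * (n * ε ^ 2) := by gcongr
              _ = n ^ 2 * ε ^ 2 := by ring
              _ ≤ (2 * k * m) ^ 2 * ε ^ 2 := by gcongr
              _ = _ := by ring
          have h2 := le_of_mul_le_mul_left h1 hk0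
          have h3 : 0 ≤ m ^ 2 * ε ^ 2 := by positivity
          nlinarith))
    have heq : (n : ℝ) * min (ε ^ 2 / l) a =
        a * min (32 * C * ((n : ℝ) * ε ^ 2 / (32 * C * (a * l)))) (n : ℝ) := by
      rw [mul_min_of_nonneg _ _ hn.le, mul_min_of_nonneg _ _ hlog.le]
      congr 1
      · field_simp
      · ring
    have hmain : ENNReal.ofReal (min c₁ c₂ * (n * min (ε ^ 2 / l) a)) ≤ p.commCost i := by
      refine le_trans (ENNReal.ofReal_le_ofReal ?_) key
      rw [heq]
      gcongr
      exact min_le_right _ _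
    refine ⟨hmain, fun hε1 => le_trans (ENNReal.ofReal_le_ofReal ?_) hmain⟩
    gcongr
    nlinarith
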